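/- Let $Q$ be a set with two binary operations $\lhd$ and $\diamond$. Call $(Q,\lhd)$ a quandle if $(a\lhd b)\lhd c=(a\lhd c)\lhd(b\lhd c)$ for all $a,b,c$, there is an operation $\widetilde\lhd$ with $(a\lhd b)\,\widetilde\lhd\, b=(a\,\widetilde\lhd\, b)\lhd b=a$ for all $a,b$, and $a\lhd a=a$ for all $a$. Call $(Q,\lhd,\diamond)$ a qualgebra if $(Q,\lhd)$ is a quandle and, for all $a,b,c\in Q$, $$(\mathrm{Comp})\ \ a\lhd(b\diamond c)=(a\lhd b)\lhd c,\qquad (\mathrm{D})\ \ (a\diamond b)\lhd c=(a\lhd c)\diamond(b\lhd c),\qquad (\mathrm{Comm})\ \ a\diamond b=b\diamond(a\lhd b).$$ Consider (sub-)diagrams of well-oriented knotted $3$-valent graphs: every vertex is a zip vertex (two arcs come in, one goes out) or an unzip vertex (one arc comes in, two go out). The arcs of a diagram are the pieces delimited by its crossings, its vertices and (for sub-diagrams) its boundary. A coloring assigns an element of $Q$ to each arc so that: (A) at a crossing, both over-arcs have the same color $b$, and if $a$ is the color of the under-arc on the right of the oriented over-strand, then the under-arc on its left has color $a\lhd b$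 (whatever the orientation of the under-strand); (B) at a vertex, drawn with the flow running down the page, if the two co-oriented arcs have colors $a$ (on the left of the page) and $b$ (on the right of the page), then the third arc has color $a\diamond b$. For a set of local moves, each usable in both directions, these rules are called topological with respect to this set if for any (sub-)diagram $D$, any coloring $\mathcal C$ of $D$ and any $D'$ obtained from $D$ by one of the moves, there is a unique coloring of $D'$ that coincides with $\mathcal C$ outside the small ball where the move takes place. The six Reidemeister moves are, with all well-oriented orientations: RI (removing a kink: coming from the top, the strand passes under, makes a loop on the right, and passes over), RII (two strands, one of which passes twice under the other, are separated), RIII (the lowest strand goes from the top left to the bottom right, the highest one from the top right to the bottom left, and the middle one, from top to bottom, is moved from the left to the right of their crossing), RIV (a strand passing under one leg of a vertex is moved so as to pass under the two other legs), RV (two legs of a vertex placed at the top cross each other before meeting, the one ending at the top right passing over the one ending at the top left, versus do not cross), and RVI (a strand passing over one leg of a vertex is moved so as to pass over the two other legs). Let $\mathrm{RIV}^z,\mathrm{RV}^z,\mathrm{RVI}^z$ be the following oriented versions: the vertex is a zip vertex whose two incoming legs come from the top (in RV, these are the legs that cross); in RIV (resp. RVI) the strand runs downwards, on one side of the move it crosses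 the outgoing leg and on the other side the two incoming legs, from the left of the vertex to its right (resp. from the right to the left). Let $\mathrm{RIV}^u,\mathrm{RV}^u,\mathrm{RVI}^u$ be the moves obtained from these by reversing all orientations, so that the vertex is an unzip vertex. Then: (1) the coloring rules (A) and (B) are topological with respect to all six moves RI–RVI if and only if $(Q,\lhd,\diamond)$ is a qualgebra; (2) if $(Q,\lhd)$ is a quandle, then the rules are topological with respect to the single move $\mathrm{RIV}^z$ if and only if (Comp) holds, and likewise for $\mathrm{RIV}^u$; they are topological with respect to $\mathrm{RV}^z$ if and only if (Comm) holds, and likewise for $\mathrm{RV}^u$; they are topological with respect to $\mathrm{RVI}^z$ if and only if (D) holds, and likewise for $\mathrm{RVI}^u$. -/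

import Mathlib

namespace GraphColoring

/-! ## Algebra: quandles and qualgebras -/

section Algebra

variable {Q : Type*}

/-- Self-distributivity `(a ◁ b) ◁ c = (a ◁ c) ◁ (b ◁ c)`. -/
def SelfDistrib (tri : Q → Q → Q) : Prop :=
  ∀ a b c, tri (tri a b) c = tri (tri a c) (tri b c)

/-- Invertibility: there is an operation `◁'` with `(a ◁ b) ◁' b = (a ◁' b) ◁ b = a`. -/
def Invertible (tri : Q → Q → Q) : Prop :=
  ∃ inv : Q → Q → Q, ∀ a b, inv (tri a b) b = a ∧ tri (inv a b) b = a

/-- Idempotence `a ◁ a = a`. -/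
def Idempotent (tri : Q → Q → Q) : Prop :=
  ∀ a, tri a a = a

/-- `(Q, ◁)` is a quandle. -/
def IsQuandle (tri : Q → Q → Q) : Prop :=
  SelfDistrib tri ∧ Invertible tri ∧ Idempotent tri

/-- Translation composability `a ◁ (b ⋄ c) = (a ◁ b) ◁ c`. -/
def TranslationComposable (tri dia : Q → Q → Q) : Prop :=
  ∀ a b c, tri a (dia b c) = tri (tri a b) c

/-- Distributivity `(a ⋄ b) ◁ c = (a ◁ c) ⋄ (b ◁ c)`. -/
def DiaDistrib (tri dia : Q → Q → Q) : Prop :=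
  ∀ a b c, tri (dia a b) c = dia (tri a c) (tri b c)

/-- Semi-commutativity `a ⋄ b = b ⋄ (a ◁ b)`. -/
def SemiCommutative (tri dia : Q → Q → Q) : Prop :=
  ∀ a b, dia a b = dia b (tri a b)

/-- `(Q, ◁, ⋄)` is a qualgebra. -/
def IsQualgebra (tri dia : Q → Q → Q) : Prop :=
  IsQuandle tri ∧ TranslationComposable tri dia ∧ DiaDistrib tri dia ∧ SemiCommutative tri dia

end Algebra

/-! ## Well-oriented 3-valent graph diagrams

A (sub-)diagram lies on an oriented sphere from which finitely many disjoint open discs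
(the *holes*) are removed.  Without holes one has a diagram of a closed graph (in the plane, the
point at infinity being forgotten); the sub-diagram inside a disc has one hole, the complement of
the disc.  Diagrams are encoded up to isotopy by their incidence data, in the style of planar
diagram codes: which arc is seen at which port of which special point or hole, the ports being
listed counterclockwise. -/

/-- The boundary pattern of a hole: the end points of arcs on its boundary circle, in the order in
which they are met when turning counterclockwise around the hole (on the sphere, the hole being
seen as a fat point); `starts j` says that the arc ending there is oriented away from the hole. -/
structure Boundary where
  n : ℕ
  starts : Fin n → Bool

/-- The pattern of the same circle seen from its other side: the direction of turning and the
roles of start and end points are exchanged. -/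
def Boundary.dual (s : Boundary) : Boundary :=
  ⟨s.n, fun j => !s.starts j.rev⟩

/-- The incidence data of a diagram with holes indexed by `ι`, of boundary patterns `t i`.

* A crossing has four ports, counterclockwise; the over-strand occupies ports `0` and `2`, the
  under-strand ports `1` and `3`.  The over-strand runs `0 → 2` if `overDir` is true and `2 → 0`
  otherwise; the under-strand runs `1 → 3` if `underDir` is true and `3 → 1` otherwise.
* A vertex has three ports, counterclockwise.  It is a zip vertex (two arcs come in, one goes out)
  or an unzip vertex (one arc comes in, two go out); `tip` is the port of the arc that is alone of
  its direction.  So sources and sinks do not occur: the graph is well-oriented.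
* `Arc` is the set of arcs, that is, of the pieces into which crossings, vertices and holes cut the
  diagram.  An arc that occurs at no port is a closed curve without special points. -/
structure DiagramData {ι : Type} (t : ι → Boundary) where
  Crossing : Type
  Vertex : Type
  Arc : Type
  overDir : Crossing → Bool
  underDir : Crossing → Bool
  isZip : Vertex → Bool
  tip : Vertex → Fin 3
  crossArc : Crossing → Fin 4 → Arc
  vertArc : Vertex → Fin 3 → Arc
  bdArc : (i : ι) → Fin (t i).n → Arc

/-- Whether the arc at port `p` of a crossing goes out of the crossing. -/
def crossingOut (overDir underDir : Bool) (p : Fin 4) : Bool :=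
  ![!overDir, !underDir, overDir, underDir] p

/-- Whether the arc at port `p` of a zip (unzip) vertex with the given tip goes out of it. -/
def vertexOut (isZip : Bool) (tip p : Fin 3) : Bool :=
  (p == tip) == isZip

namespace DiagramData

variable {ι : Type} {t : ι → Boundary}

/-- Ends of arcs: the ports of crossings, vertices and holes. -/
abbrev Port (D : DiagramData t) : Type :=
  (D.Crossing × Fin 4) ⊕ (D.Vertex × Fin 3) ⊕ (Σ i : ι, Fin (t i).n)

/-- The arc seen at a port. -/
def arcAt (D : DiagramData t) : D.Port → D.Arc
  | .inl (c, p) => D.crossArc c p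
  | .inr (.inl (v, p)) => D.vertArc v p
  | .inr (.inr ⟨i, p⟩) => D.bdArc i p

/-- Whether the arc seen at a port starts there (otherwise it ends there). -/
def startsAt (D : DiagramData t) : D.Port → Bool
  | .inl (c, p) => crossingOut (D.overDir c) (D.underDir c) p
  | .inr (.inl (v, p)) => vertexOut (D.isZip v) (D.tip v) p
  | .inr (.inr ⟨i, p⟩) => (t i).starts p

/-- The next port counterclockwise around the same special point or hole. -/
def rot (D : DiagramData t) : D.Port → D.Port
  | .inl (c, p) => .inl (c, finRotate 4 p)
  | .inr (.inl (v, p)) => .inr (.inl (v, finRotate 3 p))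
  | .inr (.inr ⟨i, p⟩) => .inr (.inr ⟨i, finRotate (t i).n p⟩)

/-- Every arc that occurs at some port has exactly one start port and exactly one end port. -/
def WellFormed (D : DiagramData t) : Prop :=
  (∀ x y : D.Port, D.startsAt x = D.startsAt y → D.arcAt x = D.arcAt y → x = y) ∧
  ∀ x : D.Port, ∃ y : D.Port, D.arcAt y = D.arcAt x ∧ D.startsAt y ≠ D.startsAt x

/-- The nodes that have a port: orbits of ports under `rot`. -/
def NodeOrbit (D : DiagramData t) : Type :=
  Quot fun x y : D.Port => y = D.rot x

/-- The faces of the ribbon graph: follow an arc to its other end, then turn. -/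
def Face (D : DiagramData t) : Type :=
  Quot fun x y : D.Port => ∃ x', x' ≠ x ∧ D.arcAt x' = D.arcAt x ∧ y = D.rot x'

/-- The connected components that have a port. -/
def Component (D : DiagramData t) : Type :=
  Quot fun x y : D.Port => y = D.rot x ∨ D.arcAt y = D.arcAt x

/-- Planarity, through the Euler characteristic of the sphere for each connected component:
nodes - edges + faces = 2 · components. -/
def Planar (D : DiagramData t) : Prop :=
  Nat.card D.NodeOrbit + Nat.card D.Face =
    Nat.card (Set.range D.arcAt) + 2 * Nat.card D.Component

/-- `D` encodes a (sub-)diagram of a well-oriented knotted 3-valent graph: finite, consistently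
oriented, and planar. -/
structure IsDiagram (D : DiagramData t) : Prop where
  finite_crossing : Finite D.Crossing
  finite_vertex : Finite D.Vertex
  finite_arc : Finite D.Arc
  wellFormed : D.WellFormed
  planar : D.Planar

end DiagramData

/-! ## Colorings -/

section Coloring

variable {Q : Type*}

/-- Rule (A).  The over-strand keeps its color `b`; if `a` is the color of the under-arc on the
right of the over-strand, then `a ◁ b` is the color of the under-arc on its left. -/
def CrossingRule (tri : Q → Q → Q) (overDir : Bool) (x : Fin 4 → Q) : Prop :=
  x 2 = x 0 ∧ if overDir then x 3 = tri (x 1) (x 0) else x 1 = tri (x 3) (x 0)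

/-- Rule (B).  With the flow running down the page, the two co-oriented arcs have colors `a` (left
on the page) and `b` (right on the page), and the third arc has color `a ⋄ b`; so the
counterclockwise order is `a ⋄ b, b, a` at a zip vertex and `a ⋄ b, a, b` at an unzip vertex. -/
def VertexRule (dia : Q → Q → Q) (isZip : Bool) (tip : Fin 3) (x : Fin 3 → Q) : Prop :=
  if isZip then x tip = dia (x (tip + 2)) (x (tip + 1))
  else x tip = dia (x (tip + 1)) (x (tip + 2))

/-- Colorings of the arcs of a diagram that obey rules (A) and (B) at all special points. -/
structure IsColoring {ι : Type} {t : ι → Boundary} (tri dia : Q → Q → Q)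
    (D : DiagramData t) (C : D.Arc → Q) : Prop where
  crossing : ∀ c, CrossingRule tri (D.overDir c) fun p => C (D.crossArc c p)
  vertex : ∀ v, VertexRule dia (D.isZip v) (D.tip v) fun p => C (D.vertArc v p)

end Coloring

/-! ## Replacing a sub-diagram inside a small ball -/

/-- A sub-diagram inside a disc: its only hole is the outside of the disc.  (So its boundary
pattern is read counterclockwise around the outside, that is, clockwise along the circle.) -/
abbrev Tangle (s : Boundary) : Type 1 :=
  DiagramData fun _ : Unit => s

/-- Boundary patterns `t`, and one more hole. -/
def addHole {ι : Type} (s : Boundary) (t : ι → Boundary) : Option ι → Boundary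
  | none => s
  | some i => t i

section Gluing

variable {ι : Type} {t : ι → Boundary} {s : Boundary}

/-- An arc of the exterior `O` meets an arc of the disc tangle `T` at a point of the circle. -/
def Meets (O : DiagramData (addHole s.dual t)) (T : Tangle s) (x y : O.Arc ⊕ T.Arc) : Prop :=
  ∃ j : Fin s.n, x = .inl (O.bdArc none (Fin.rev j)) ∧ y = .inr (T.bdArc () j)

/-- `D` is cut by the boundary circle of a small ball into the exterior `O` and the tangle `T`
inside the ball.  The special points of `D` are those of `O` and those of `T`; the arcs of `D` are
obtained from those of `O` and of `T` by joining the ones that meet on the circle. -/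
structure Gluing (O : DiagramData (addHole s.dual t)) (T : Tangle s) (D : DiagramData t) where
  crossing : O.Crossing ⊕ T.Crossing ≃ D.Crossing
  vertex : O.Vertex ⊕ T.Vertex ≃ D.Vertex
  arc : O.Arc ⊕ T.Arc → D.Arc
  arc_surjective : Function.Surjective arc
  arc_eq_iff : ∀ x y, arc x = arc y ↔ Relation.EqvGen (Meets O T) x y
  overDir_crossing : ∀ c, D.overDir (crossing c) = Sum.elim O.overDir T.overDir c
  underDir_crossing : ∀ c, D.underDir (crossing c) = Sum.elim O.underDir T.underDir c
  isZip_vertex : ∀ v, D.isZip (vertex v) = Sum.elim O.isZip T.isZip v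
  tip_vertex : ∀ v, D.tip (vertex v) = Sum.elim O.tip T.tip v
  crossArc_inl : ∀ c p, D.crossArc (crossing (.inl c)) p = arc (.inl (O.crossArc c p))
  crossArc_inr : ∀ c p, D.crossArc (crossing (.inr c)) p = arc (.inr (T.crossArc c p))
  vertArc_inl : ∀ v p, D.vertArc (vertex (.inl v)) p = arc (.inl (O.vertArc v p))
  vertArc_inr : ∀ v p, D.vertArc (vertex (.inr v)) p = arc (.inr (T.vertArc v p))
  bdArc_eq : ∀ (i : ι) (p : Fin (t i).n), D.bdArc i p = arc (.inl (O.bdArc (some i) p))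

end Gluing

/-- A local move: two tangles in a disc with the same boundary. -/
structure Move where
  boundary : Boundary
  lhs : Tangle boundary
  rhs : Tangle boundary

section Topological

variable {Q : Type*}

/-- For every (sub-)diagram `D`, every coloring `C` of `D` and every `D'` obtained from `D` by
replacing a tangle `T` inside a small ball by `T'`, there is a unique coloring of `D'` coinciding
with `C` outside the ball. -/
def ColoringsExtend (tri dia : Q → Q → Q) {s : Boundary} (T T' : Tangle s) : Prop :=
  ∀ (ι : Type) [Finite ι] (t : ι → Boundary) (O : DiagramData (addHole s.dual t))
    (D D' : DiagramData t), O.IsDiagram → D.IsDiagram → D'.IsDiagram →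
    ∀ (g : Gluing O T D) (g' : Gluing O T' D') (C : D.Arc → Q), IsColoring tri dia D C →
      ∃! C' : D'.Arc → Q,
        IsColoring tri dia D' C' ∧ ∀ a : O.Arc, C' (g'.arc (.inl a)) = C (g.arc (.inl a))

/-- Rules (A) and (B) are topological with respect to a set of local moves, each of which may be
applied in both directions. -/
def IsTopological (tri dia : Q → Q → Q) (M : Set Move) : Prop :=
  ∀ m ∈ M, ColoringsExtend tri dia m.lhs m.rhs ∧ ColoringsExtend tri dia m.rhs m.lhs

end Topological

/-! ## The six Reidemeister moves, with all well-oriented orientations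

The boundary points are listed clockwise along the circle, starting at the top left. -/

/-- RI: a kink versus a straight strand.  Boundary: top, bottom.  The strand runs downwards if `d`
is true.  Coming from the top, it passes under, makes a loop on the right, and passes over.
Arcs of the kink: `0` top, `1` loop, `2` bottom. -/
def moveI (d : Bool) : Move where
  boundary := ⟨2, ![d, !d]⟩
  lhs :=
    { Crossing := Fin 1, Vertex := Fin 0, Arc := Fin 3
      overDir := ![!d], underDir := ![!d], isZip := ![], tip := ![]
      crossArc := ![![2, 1, 1, 0]], vertArc := ![], bdArc := fun _ => ![0, 2] }
  rhs :=
    { Crossing := Fin 0, Vertex := Fin 0, Arc := Fin 1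
      overDir := ![], underDir := ![], isZip := ![], tip := ![]
      crossArc := ![], vertArc := ![], bdArc := fun _ => ![0, 0] }

/-- RII: a strand `A`, with both ends on the right, passes under a strand `B`, with both ends on
the left, twice, versus no crossing.  Boundary: top of `B`, top of `A`, bottom of `A`, bottom
of `B`.  The strand `A` (`B`) runs upwards if `a` (`b`) is true.
Arcs with crossings: `0, 1, 2` are `B` from bottom to top, `3, 4, 5` are `A` from bottom to top.
The crossings are the lower and the upper one. -/
def moveII (a b : Bool) : Move where
  boundary := ⟨4, ![!b, !a, a, b]⟩
  lhs :=
    { Crossing := Fin 2, Vertex := Fin 0, Arc := Fin 6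
      overDir := ![b, b], underDir := ![a, !a], isZip := ![], tip := ![]
      crossArc := ![![0, 3, 1, 4], ![1, 5, 2, 4]], vertArc := ![]
      bdArc := fun _ => ![2, 5, 3, 0] }
  rhs :=
    { Crossing := Fin 0, Vertex := Fin 0, Arc := Fin 2
      overDir := ![], underDir := ![], isZip := ![], tip := ![]
      crossArc := ![], vertArc := ![], bdArc := fun _ => ![0, 1, 1, 0] }

/-- RIII: the lowest strand `U` goes from the top left to the bottom right, the middle strand `M`
from the top to the bottom, the highest strand `V` from the top right to the bottom left; `M`
passes on the left (left-hand side) or on the right (right-hand side) of the crossing of `U`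
and `V`.  Boundary: tops of `U`, `M`, `V`, bottoms of `U`, `M`, `V`.  A strand runs downwards if
its parameter is true.
Arcs: `0, 1, 2` are `U`, `3, 4, 5` are `M`, `6, 7, 8` are `V`, from top to bottom.
Crossings on the left-hand side: `M` over `U`, `V` over `U`, `V` over `M`; on the right-hand side:
`V` over `M`, `V` over `U`, `M` over `U`. -/
def moveIII (u m v : Bool) : Move where
  boundary := ⟨6, ![u, m, v, !u, !m, !v]⟩
  lhs :=
    { Crossing := Fin 3, Vertex := Fin 0, Arc := Fin 9
      overDir := ![!m, !v, !v], underDir := ![!u, !u, !m], isZip := ![], tip := ![]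
      crossArc := ![![4, 1, 3, 0], ![7, 2, 6, 1], ![8, 5, 7, 4]], vertArc := ![]
      bdArc := fun _ => ![0, 3, 6, 2, 5, 8] }
  rhs :=
    { Crossing := Fin 3, Vertex := Fin 0, Arc := Fin 9
      overDir := ![!v, !v, !m], underDir := ![!m, !u, !u], isZip := ![], tip := ![]
      crossArc := ![![7, 4, 6, 3], ![8, 1, 7, 0], ![5, 2, 4, 1]], vertArc := ![]
      bdArc := fun _ => ![0, 3, 6, 2, 5, 8] }

/-- RIV: a strand `S` from the top left to the bottom right passes under the leg `0` (going to the
bottom left) of a vertex, versus under the legs `2` (going to the top) and `1` (going to the top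
right).  Boundary: top of `S`, leg `2`, leg `1`, bottom of `S`, leg `0`.  The strand `S` runs
downwards if `d` is true; the vertex is of type zip if `z` is true and of type unzip otherwise,
with tip `j`.
Arcs on the left-hand side: `0, 1` are `S` from top to bottom, `2, 3` are leg `0` from the vertex
outwards, `4` is leg `1`, `5` is leg `2`.  On the right-hand side: `0, 1, 2` are `S` from top to
bottom, `3` is leg `0`, `4, 5` are leg `2` and `6, 7` are leg `1` from the vertex outwards; the
crossings are those with leg `2` and with leg `1`. -/
def moveIV (d z : Bool) (j : Fin 3) : Move where
  boundary := ⟨5, ![d, !vertexOut z j 2, !vertexOut z j 1, !d, !vertexOut z j 0]⟩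
  lhs :=
    { Crossing := Fin 1, Vertex := Fin 1, Arc := Fin 6
      overDir := ![!vertexOut z j 0], underDir := ![!d], isZip := ![z], tip := ![j]
      crossArc := ![![3, 1, 2, 0]], vertArc := ![![2, 4, 5]]
      bdArc := fun _ => ![0, 5, 4, 1, 3] }
  rhs :=
    { Crossing := Fin 2, Vertex := Fin 1, Arc := Fin 8
      overDir := ![vertexOut z j 2, vertexOut z j 1], underDir := ![!d, !d]
      isZip := ![z], tip := ![j]
      crossArc := ![![4, 1, 5, 0], ![6, 2, 7, 1]], vertArc := ![![3, 6, 4]]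
      bdArc := fun _ => ![0, 5, 7, 2, 3] }

/-- RV: two legs of a vertex, coming from the top, cross each other before they meet, versus no
crossing.  On the right-hand side the vertex has legs `0` (going to the bottom), `1` (to the top
right) and `2` (to the top left), and it is of type zip if `z` is true and of type unzip otherwise,
with tip `j`.  On the left-hand side the leg ending at the top right passes over the one ending at
the top left, and they reach the vertex at ports `2` and `1`; so the tip is `-j`, ports `1` and `2`
being exchanged.  Boundary: top left, top right, bottom.
Arcs on the left-hand side: `0` bottom, `1, 2` from port `1` of the vertex to the top left, `3, 4`
from port `2` of the vertex to the top right.  On the right-hand side: leg `i` is the arc `i`. -/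
def moveV (z : Bool) (j : Fin 3) : Move where
  boundary := ⟨3, ![!vertexOut z j 2, !vertexOut z j 1, !vertexOut z j 0]⟩
  lhs :=
    { Crossing := Fin 1, Vertex := Fin 1, Arc := Fin 5
      overDir := ![vertexOut z j 1], underDir := ![vertexOut z j 2]
      isZip := ![z], tip := ![-j]
      crossArc := ![![3, 1, 4, 2]], vertArc := ![![0, 1, 3]]
      bdArc := fun _ => ![2, 4, 0] }
  rhs :=
    { Crossing := Fin 0, Vertex := Fin 1, Arc := Fin 3
      overDir := ![], underDir := ![], isZip := ![z], tip := ![j]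
      crossArc := ![], vertArc := ![![0, 1, 2]], bdArc := fun _ => ![2, 1, 0] }

/-- RVI: a strand `S` from the top right to the bottom left passes over the leg `0` (going to the
bottom right) of a vertex, versus over the legs `1` (going to the top) and `2` (going to the top
left).  Boundary: leg `2`, leg `1`, top of `S`, leg `0`, bottom of `S`.  The strand `S` runs
downwards if `d` is true; the vertex is of type zip if `z` is true and of type unzip otherwise,
with tip `j`.
Arcs on the left-hand side: `0, 1` are `S` from top to bottom, `2, 3` are leg `0` from the vertex
outwards, `4` is leg `1`, `5` is leg `2`.  On the right-hand side: `0, 1, 2` are `S` from top to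
bottom, `3` is leg `0`, `4, 5` are leg `1` and `6, 7` are leg `2` from the vertex outwards; the
crossings are those with leg `1` and with leg `2`. -/
def moveVI (d z : Bool) (j : Fin 3) : Move where
  boundary := ⟨5, ![!vertexOut z j 2, !vertexOut z j 1, d, !vertexOut z j 0, !d]⟩
  lhs :=
    { Crossing := Fin 1, Vertex := Fin 1, Arc := Fin 6
      overDir := ![!d], underDir := ![!vertexOut z j 0], isZip := ![z], tip := ![j]
      crossArc := ![![1, 3, 0, 2]], vertArc := ![![2, 4, 5]]
      bdArc := fun _ => ![5, 4, 0, 3, 1] }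
  rhs :=
    { Crossing := Fin 2, Vertex := Fin 1, Arc := Fin 8
      overDir := ![!d, !d], underDir := ![vertexOut z j 1, vertexOut z j 2]
      isZip := ![z], tip := ![j]
      crossArc := ![![1, 4, 0, 5], ![2, 6, 1, 7]], vertArc := ![![3, 4, 6]]
      bdArc := fun _ => ![7, 5, 0, 3, 2] }

/-- The R-moves for well-oriented 3-valent graph diagrams: all well-oriented versions of the moves
RI to RVI. -/
inductive RMove : Set Move
  | I (d : Bool) : RMove (moveI d)
  | II (a b : Bool) : RMove (moveII a b)
  | III (u m v : Bool) : RMove (moveIII u m v)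
  | IV (d z : Bool) (j : Fin 3) : RMove (moveIV d z j)
  | V (z : Bool) (j : Fin 3) : RMove (moveV z j)
  | VI (d z : Bool) (j : Fin 3) : RMove (moveVI d z j)

/-- RIV with a zip vertex whose legs at the top come in; the strand runs downwards. -/
def moveIVz : Move := moveIV true true 0

/-- RIV with an unzip vertex whose legs at the top go out; the strand runs upwards. -/
def moveIVu : Move := moveIV false false 0

/-- RV with a zip vertex whose legs at the top come in. -/
def moveVz : Move := moveV true 0

/-- RV with an unzip vertex whose legs at the top go out. -/
def moveVu : Move := moveV false 0

/-- RVI with a zip vertex whose legs at the top come in; the strand runs downwards. -/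
def moveVIz : Move := moveVI true true 0

/-- RVI with an unzip vertex whose legs at the top go out; the strand runs upwards. -/
def moveVIu : Move := moveVI false false 0

end GraphColoring

namespace GraphColoring

/-! ## Planarity of diagrams given by labelled faces -/

/-- If the classes of `r` are separated by `f`, and each class contains a single element of rank
`0` from which all others are reached, then `f` counts the classes. -/
theorem card_quot_eq_of_rank {α β : Type*} {r : α → α → Prop} (f : α → β) (rank : α → ℕ)
    (hf : ∀ x y, r x y → f x = f y) (hsurj : Function.Surjective f)
    (hinj : ∀ x y, rank x = 0 → rank y = 0 → f x = f y → x = y)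
    (hpred : ∀ y, rank y ≠ 0 → ∃ x, r x y ∧ rank x < rank y) :
    Nat.card (Quot r) = Nat.card β := by
  have key : ∀ n y, rank y = n → ∃ x, rank x = 0 ∧ Quot.mk r x = Quot.mk r y := by
    intro n
    induction n using Nat.strong_induction_on with
    | _ n ih =>
      intro y hy
      by_cases h0 : rank y = 0
      · exact ⟨y, h0, rfl⟩
      · obtain ⟨x, hxy, hlt⟩ := hpred y h0
        obtain ⟨w, hw, hwx⟩ := ih _ (hy ▸ hlt) x rfl
        exact ⟨w, hw, hwx.trans (Quot.sound hxy)⟩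
  refine Nat.card_congr (Equiv.ofBijective (Quot.lift f hf) ⟨?_, ?_⟩)
  · rintro ⟨x⟩ ⟨y⟩ hxy
    obtain ⟨x', hx', hxx⟩ := key _ x rfl
    obtain ⟨y', hy', hyy⟩ := key _ y rfl
    change Quot.lift f hf (Quot.mk r x) = Quot.lift f hf (Quot.mk r y) at hxy
    rw [← hxx, ← hyy] at hxy
    exact hxx.symm.trans ((congrArg _ (hinj _ _ hx' hy' hxy)).trans hyy)
  · intro b
    obtain ⟨x, rfl⟩ := hsurj b
    exact ⟨Quot.mk r x, rfl⟩

theorem exists_finRotate_eq {n : ℕ} (p : Fin n) (hp : p.val ≠ 0) :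
    ∃ q : Fin n, finRotate n q = p ∧ q.val < p.val := by
  obtain _ | n := n
  · exact p.elim0
  · refine ⟨⟨p.val - 1, by omega⟩, ?_, ?_⟩
    · have h : (⟨p.val - 1, by omega⟩ : Fin (n + 1)) =
          ⟨p.val - 1, lt_trans (by omega : p.val - 1 < n) n.lt_succ_self⟩ := rfl
      rw [h, finRotate_of_lt (by omega)]
      ext
      simp only
      omega
    · simp only
      omega

namespace DiagramData

variable {ι : Type} {t : ι → Boundary}

theorem rot_surjective (D : DiagramData t) : Function.Surjective D.rot := by
  rintro (⟨c, p⟩ | ⟨v, p⟩ | ⟨i, p⟩)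
  · exact ⟨.inl (c, (finRotate 4).symm p), by simp only [rot, Equiv.apply_symm_apply]⟩
  · exact ⟨.inr (.inl (v, (finRotate 3).symm p)), by simp only [rot, Equiv.apply_symm_apply]⟩
  · exact ⟨.inr (.inr ⟨i, (finRotate (t i).n).symm p⟩), by
      simp only [rot, Equiv.apply_symm_apply]⟩

/-- The special point or hole of a port. -/
def node (D : DiagramData t) : D.Port → D.Crossing ⊕ D.Vertex ⊕ ι
  | .inl (c, _) => .inl c
  | .inr (.inl (v, _)) => .inr (.inl v)
  | .inr (.inr ⟨i, _⟩) => .inr (.inr i)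

/-- The number of a port around its special point or hole. -/
def portIndex (D : DiagramData t) : D.Port → ℕ
  | .inl (_, p) => p
  | .inr (.inl (_, p)) => p
  | .inr (.inr ⟨_, p⟩) => p

theorem node_rot (D : DiagramData t) (x : D.Port) : D.node (D.rot x) = D.node x := by
  obtain ⟨c, p⟩ | ⟨v, p⟩ | ⟨i, p⟩ := x <;> rfl

theorem eq_of_node_eq (D : DiagramData t) {x y : D.Port} (h : D.node x = D.node y)
    (h' : D.portIndex x = D.portIndex y) : x = y := by
  obtain ⟨c, p⟩ | ⟨v, p⟩ | ⟨i, p⟩ := x <;> obtain ⟨c', p'⟩ | ⟨v', p'⟩ | ⟨i', p'⟩ := y <;>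
    simp only [node, Sum.inl.injEq, Sum.inr.injEq, reduceCtorEq] at h <;> subst h <;>
    rw [Fin.ext h']

theorem exists_rot_eq (D : DiagramData t) (y : D.Port) (hy : D.portIndex y ≠ 0) :
    ∃ x, D.rot x = y ∧ D.portIndex x < D.portIndex y := by
  obtain ⟨c, p⟩ | ⟨v, p⟩ | ⟨i, p⟩ := y
  · obtain ⟨q, rfl, h⟩ := exists_finRotate_eq p hy
    exact ⟨.inl (c, q), rfl, h⟩
  · obtain ⟨q, rfl, h⟩ := exists_finRotate_eq p hy
    exact ⟨.inr (.inl (v, q)), rfl, h⟩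
  · obtain ⟨q, rfl, h⟩ := exists_finRotate_eq p hy
    exact ⟨.inr (.inr ⟨i, q⟩), rfl, h⟩

/-- Each orbit has exactly one port of index `0`. A hole without end points would be counted on the
right but carries no port, whence the positivity hypothesis. -/
theorem card_nodeOrbit (D : DiagramData t) (ht : ∀ i, 0 < (t i).n) :
    Nat.card D.NodeOrbit = Nat.card (D.Crossing ⊕ D.Vertex ⊕ ι) := by
  refine card_quot_eq_of_rank D.node D.portIndex ?_ ?_ ?_ ?_
  · rintro x y rfl
    exact (D.node_rot x).symm
  · rintro (c | v | i)
    · exact ⟨.inl (c, 0), rfl⟩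
    · exact ⟨.inr (.inl (v, 0)), rfl⟩
    · exact ⟨.inr (.inr ⟨i, ⟨0, ht i⟩⟩), rfl⟩
  · intro x y hx hy h
    exact D.eq_of_node_eq h (hx.trans hy.symm)
  · intro y hy
    obtain ⟨x, rfl, h⟩ := D.exists_rot_eq y hy
    exact ⟨x, rfl, h⟩

/-- Ports of the same special point or hole lie in the same component. -/
theorem component_eq_of_node_eq (D : DiagramData t) {x y : D.Port} (h : D.node x = D.node y) :
    (Quot.mk _ x : D.Component) = Quot.mk _ y := by
  have key : ∀ n (x : D.Port), D.portIndex x = n →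
      ∃ w, D.portIndex w = 0 ∧ D.node w = D.node x ∧
        (Quot.mk _ w : D.Component) = Quot.mk _ x := by
    intro n
    induction n using Nat.strong_induction_on with
    | _ n ih =>
      intro x hx
      by_cases h0 : D.portIndex x = 0
      · exact ⟨x, h0, rfl, rfl⟩
      · obtain ⟨x', rfl, hlt⟩ := D.exists_rot_eq x h0
        obtain ⟨w, hw, hwx, hq⟩ := ih _ (hx ▸ hlt) x' rfl
        exact ⟨w, hw, hwx.trans (D.node_rot x').symm, hq.trans (Quot.sound (.inl rfl))⟩
  obtain ⟨x', hx, hxn, hxx⟩ := key _ x rfl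
  obtain ⟨y', hy, hyn, hyy⟩ := key _ y rfl
  have : x' = y' := D.eq_of_node_eq (hxn.trans (h.trans hyn.symm)) (hx.trans hy.symm)
  rw [← hxx, ← hyy, this]

theorem component_eq_of_arcAt_eq (D : DiagramData t) {x y : D.Port}
    (h : D.arcAt x = D.arcAt y) : (Quot.mk _ x : D.Component) = Quot.mk _ y :=
  Quot.sound (.inr h.symm)

/-- Faces can be counted by numbering the ports along each of them. -/
theorem card_face (D : DiagramData t) (hD : D.WellFormed) {k : ℕ} (label : D.Port → Fin k × ℕ)
    (hinj : ∀ x y, label x = label y → x = y) (hsurj : ∀ i, ∃ x, (label x).1 = i)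
    (hstep : ∀ x y, y ≠ x → D.arcAt y = D.arcAt x → (label x).1 = (label (D.rot y)).1 ∧
      ((label (D.rot y)).2 = 0 ∨ (label (D.rot y)).2 = (label x).2 + 1)) :
    Nat.card D.Face = k := by
  refine (card_quot_eq_of_rank (fun x => (label x).1) (fun x => (label x).2) ?_ hsurj ?_
    ?_).trans (Nat.card_fin k)
  · rintro x _ ⟨y, hne, harc, rfl⟩
    exact (hstep x y hne harc).1
  · intro x y hx hy h
    exact hinj x y (Prod.ext h (hx.trans hy.symm))
  · intro y hy
    obtain ⟨y, rfl⟩ := D.rot_surjective y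
    -- The predecessor of `rot y` along its face is the other end of the arc at `y`.
    obtain ⟨x, harc, hs⟩ := hD.2 y
    have hne : y ≠ x := by
      rintro rfl
      exact hs rfl
    refine ⟨x, ⟨y, hne, harc.symm, rfl⟩, ?_⟩
    have := ((hstep x y hne harc.symm).2).resolve_left hy
    simp only [this]
    exact Nat.lt_succ_self _

end DiagramData

/-- Port labels from separate tables for the crossings, the vertices and the outside. -/
def portLabel {s : Boundary} (T : Tangle s) {β : Type*} (fc : T.Crossing → Fin 4 → β)
    (fv : T.Vertex → Fin 3 → β) (fb : Fin s.n → β) : T.Port → β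
  | .inl (c, p) => fc c p
  | .inr (.inl (v, p)) => fv v p
  | .inr (.inr ⟨_, p⟩) => fb p

/-! ### Tangles with finite incidence data: planarity by computation -/

section FinTangle

variable (s : Boundary) {c v a : ℕ} (overDir underDir : Fin c → Bool)
  (isZip : Fin v → Bool) (tip : Fin v → Fin 3) (crossArc : Fin c → Fin 4 → Fin a)
  (vertArc : Fin v → Fin 3 → Fin a) (bdArc : Fin s.n → Fin a)

/-- The tangle with the given finite incidence data. -/
abbrev finTangle : Tangle s where
  Crossing := Fin c
  Vertex := Fin v
  Arc := Fin a
  overDir := overDir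
  underDir := underDir
  isZip := isZip
  tip := tip
  crossArc := crossArc
  vertArc := vertArc
  bdArc := fun _ => bdArc

local notation "𝕋" => finTangle s overDir underDir isZip tip crossArc vertArc bdArc

instance : Fintype (DiagramData.Port 𝕋) :=
  inferInstanceAs (Fintype ((Fin c × Fin 4) ⊕ (Fin v × Fin 3) ⊕ (Σ _ : Unit, Fin s.n)))

instance : DecidableEq (DiagramData.Port 𝕋) :=
  inferInstanceAs (DecidableEq ((Fin c × Fin 4) ⊕ (Fin v × Fin 3) ⊕ (Σ _ : Unit, Fin s.n)))

instance : DecidableEq (DiagramData.Arc 𝕋) :=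
  inferInstanceAs (DecidableEq (Fin a))

instance : Decidable (DiagramData.WellFormed 𝕋) := by
  unfold DiagramData.WellFormed
  infer_instance

/-- The labels number the `k` faces of a tangle and the ports along each face, the tangle is
connected through its boundary, and the number of faces is as required by Euler's formula. -/
def IsFaceNumbering {k : ℕ} (fc : Fin c → Fin 4 → Fin k × ℕ) (fv : Fin v → Fin 3 → Fin k × ℕ)
    (fb : Fin s.n → Fin k × ℕ) : Prop :=
  0 < s.n ∧ c + v + 1 + k = a + 2 ∧ (∀ i, ∃ p j, crossArc i p = bdArc j) ∧
  (∀ i, ∃ p j, vertArc i p = bdArc j) ∧ (∀ i : Fin a, ∃ x, DiagramData.arcAt 𝕋 x = i) ∧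
  (∀ x y, portLabel 𝕋 fc fv fb x = portLabel 𝕋 fc fv fb y → x = y) ∧
  (∀ i, ∃ x, (portLabel 𝕋 fc fv fb x).1 = i) ∧
  ∀ x y, y ≠ x → DiagramData.arcAt 𝕋 y = DiagramData.arcAt 𝕋 x →
    (portLabel 𝕋 fc fv fb x).1 = (portLabel 𝕋 fc fv fb (DiagramData.rot 𝕋 y)).1 ∧
    ((portLabel 𝕋 fc fv fb (DiagramData.rot 𝕋 y)).2 = 0 ∨
      (portLabel 𝕋 fc fv fb (DiagramData.rot 𝕋 y)).2 = (portLabel 𝕋 fc fv fb x).2 + 1)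

instance {k : ℕ} (fc : Fin c → Fin 4 → Fin k × ℕ) (fv : Fin v → Fin 3 → Fin k × ℕ)
    (fb : Fin s.n → Fin k × ℕ) : Decidable
      (IsFaceNumbering s overDir underDir isZip tip crossArc vertArc bdArc fc fv fb) := by
  unfold IsFaceNumbering
  infer_instance

variable {s overDir underDir isZip tip crossArc vertArc bdArc}

/-- The cardinalities of quotients in Euler's formula are certified by explicit labels. Only `hwf`
depends on orientations; the face numbering does not mention them, so for the moves it evaluates by
`rfl` even with the parameters left free. -/
theorem isDiagram_finTangle {k : ℕ} (fc : Fin c → Fin 4 → Fin k × ℕ)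
    (fv : Fin v → Fin 3 → Fin k × ℕ) (fb : Fin s.n → Fin k × ℕ)
    (hwf : decide (DiagramData.WellFormed 𝕋) = true)
    (h : decide (IsFaceNumbering s overDir underDir isZip tip crossArc vertArc bdArc fc fv fb) =
      true) : DiagramData.IsDiagram 𝕋 := by
  replace hwf := of_decide_eq_true hwf
  replace h := of_decide_eq_true h
  obtain ⟨hs, heuler, hc, hv, harc, hinj, hsurj, hstep⟩ := h
  set T := finTangle s overDir underDir isZip tip crossArc vertArc bdArc with hT
  refine ⟨inferInstanceAs (Finite (Fin c)), inferInstanceAs (Finite (Fin v)),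
    inferInstanceAs (Finite (Fin a)), hwf, ?_⟩
  -- The extra node is the outside of the disc.
  have hnode : Nat.card T.NodeOrbit = c + (v + 1) := by
    rw [T.card_nodeOrbit fun _ => hs]
    change Nat.card (Fin c ⊕ Fin v ⊕ Unit) = _
    simp
  have hface : Nat.card T.Face = k := T.card_face hwf _ hinj hsurj hstep
  have hrange : Nat.card (Set.range T.arcAt) = a := by
    rw [Set.range_eq_univ.2 harc, Nat.card_univ]
    exact Nat.card_fin a
  have hcomp : Nat.card T.Component = 1 := by
    let root : T.Port := .inr (.inr ⟨(), ⟨0, hs⟩⟩)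
    have hbd : ∀ j : Fin s.n,
        (Quot.mk _ (.inr (.inr ⟨(), j⟩)) : T.Component) = Quot.mk _ root :=
      fun j => T.component_eq_of_node_eq rfl
    rw [Nat.card_eq_one_iff_unique]
    refine ⟨⟨?_⟩, ⟨Quot.mk _ root⟩⟩
    have : ∀ x : T.Port, (Quot.mk _ x : T.Component) = Quot.mk _ root := by
      rintro (⟨i, p⟩ | ⟨i, p⟩ | ⟨_, j⟩)
      · obtain ⟨q, j, h⟩ := hc i
        refine Eq.trans (b := Quot.mk _ (.inl (i, q))) ?_
          ((T.component_eq_of_arcAt_eq ?_).trans (hbd j))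
        · exact T.component_eq_of_node_eq rfl
        · exact h
      · obtain ⟨q, j, h⟩ := hv i
        refine Eq.trans (b := Quot.mk _ (.inr (.inl (i, q)))) ?_
          ((T.component_eq_of_arcAt_eq ?_).trans (hbd j))
        · exact T.component_eq_of_node_eq rfl
        · exact h
      · exact hbd j
    rintro ⟨x⟩ ⟨y⟩
    exact (this x).trans (this y).symm
  rw [DiagramData.Planar, hnode, hface, hrange, hcomp]
  omega

end FinTangle

/-! ### The tangles of the six moves are planar diagrams -/

theorem isDiagram_moveI_lhs (d : Bool) : (moveI d).lhs.IsDiagram := by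
  -- `k` is the number of regions into which the tangle cuts the disc; a label `(i, m)` marks the
  -- port at position `m` on the face `i`. The tables are for crossings, vertices and the outside.
  refine isDiagram_finTangle (s := (moveI d).boundary) (k := 3)
    ![![(0, 0), (1, 0), (2, 0), (1, 1)]]
    ![]
    ![(0, 1), (1, 2)] ?_ rfl
  revert d
  decide +kernel

theorem isDiagram_moveI_rhs (d : Bool) : (moveI d).rhs.IsDiagram := by
  refine isDiagram_finTangle (s := (moveI d).boundary) (k := 2)
    ![]
    ![]
    ![(0, 0), (1, 0)] ?_ rfl
  revert d
  decide +kernel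

theorem isDiagram_moveII_lhs (a b : Bool) : (moveII a b).lhs.IsDiagram := by
  refine isDiagram_finTangle (s := (moveII a b).boundary) (k := 5)
    ![![(0, 0), (1, 0), (2, 0), (3, 0)],
      ![(3, 1), (2, 1), (4, 0), (0, 2)]]
    ![]
    ![(0, 1), (4, 1), (2, 2), (1, 1)] ?_ rfl
  revert a b
  decide +kernel

theorem isDiagram_moveII_rhs (a b : Bool) : (moveII a b).rhs.IsDiagram := by
  refine isDiagram_finTangle (s := (moveII a b).boundary) (k := 3)
    ![]
    ![]
    ![(0, 0), (1, 0), (2, 0), (1, 1)] ?_ rfl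
  revert a b
  decide +kernel

theorem isDiagram_moveIII_lhs (u m v : Bool) : (moveIII u m v).lhs.IsDiagram := by
  refine isDiagram_finTangle (s := (moveIII u m v).boundary) (k := 7)
    ![![(0, 0), (1, 0), (2, 0), (3, 0)],
      ![(1, 1), (4, 0), (5, 0), (2, 2)],
      ![(0, 1), (6, 0), (4, 2), (1, 2)]]
    ![]
    ![(0, 2), (3, 1), (2, 1), (5, 1), (4, 1), (6, 1)] ?_ rfl
  revert u m v
  decide +kernel

theorem isDiagram_moveIII_rhs (u m v : Bool) : (moveIII u m v).rhs.IsDiagram := by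
  refine isDiagram_finTangle (s := (moveIII u m v).boundary) (k := 7)
    ![![(0, 0), (1, 0), (2, 0), (3, 0)],
      ![(4, 0), (5, 0), (1, 2), (0, 1)],
      ![(5, 1), (6, 0), (2, 2), (1, 1)]]
    ![]
    ![(4, 1), (0, 2), (3, 1), (2, 1), (6, 1), (5, 2)] ?_ rfl
  revert u m v
  decide +kernel

theorem isDiagram_moveIV_lhs (d z : Bool) (j : Fin 3) : (moveIV d z j).lhs.IsDiagram := by
  refine isDiagram_finTangle (s := (moveIV d z j).boundary) (k := 5)
    ![![(0, 0), (1, 0), (2, 0), (3, 0)]]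
    ![![(3, 2), (2, 1), (4, 0)]]
    ![(0, 1), (3, 1), (4, 1), (2, 2), (1, 1)] ?_ rfl
  revert d z j
  decide +kernel

theorem isDiagram_moveIV_rhs (d z : Bool) (j : Fin 3) : (moveIV d z j).rhs.IsDiagram := by
  refine isDiagram_finTangle (s := (moveIV d z j).boundary) (k := 6)
    ![![(0, 0), (1, 0), (2, 0), (3, 0)],
      ![(1, 1), (4, 0), (5, 0), (2, 2)]]
    ![![(0, 1), (4, 2), (1, 2)]]
    ![(0, 2), (3, 1), (2, 1), (5, 1), (4, 1)] ?_ rfl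
  revert d z j
  decide +kernel

theorem isDiagram_moveV_lhs (z : Bool) (j : Fin 3) : (moveV z j).lhs.IsDiagram := by
  refine isDiagram_finTangle (s := (moveV z j).boundary) (k := 4)
    ![![(0, 0), (1, 0), (2, 0), (3, 0)]]
    ![![(0, 1), (2, 2), (1, 1)]]
    ![(0, 2), (3, 1), (2, 1)] ?_ rfl
  revert z j
  decide +kernel

theorem isDiagram_moveV_rhs (z : Bool) (j : Fin 3) : (moveV z j).rhs.IsDiagram := by
  refine isDiagram_finTangle (s := (moveV z j).boundary) (k := 3)
    ![]
    ![![(0, 0), (1, 0), (2, 0)]]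
    ![(0, 1), (2, 1), (1, 1)] ?_ rfl
  revert z j
  decide +kernel

theorem isDiagram_moveVI_lhs (d z : Bool) (j : Fin 3) : (moveVI d z j).lhs.IsDiagram := by
  refine isDiagram_finTangle (s := (moveVI d z j).boundary) (k := 5)
    ![![(0, 0), (1, 0), (2, 0), (3, 0)]]
    ![![(0, 2), (3, 1), (4, 0)]]
    ![(0, 1), (4, 1), (3, 2), (2, 1), (1, 1)] ?_ rfl
  revert d z j
  decide +kernel

theorem isDiagram_moveVI_rhs (d z : Bool) (j : Fin 3) : (moveVI d z j).rhs.IsDiagram := by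
  refine isDiagram_finTangle (s := (moveVI d z j).boundary) (k := 6)
    ![![(0, 0), (1, 0), (2, 0), (3, 0)],
      ![(4, 0), (5, 0), (1, 2), (0, 1)]]
    ![![(5, 1), (2, 2), (1, 1)]]
    ![(4, 1), (0, 2), (3, 1), (2, 1), (5, 2)] ?_ rfl
  revert d z j
  decide +kernel

/-! ## Reduction to the tangles in the ball -/

section Local

variable {Q : Type*} {s : Boundary}

/-- Every coloring of `T` has a unique counterpart on `T'` with the same boundary colors. -/
def TangleColoringsExtend (tri dia : Q → Q → Q) (T T' : Tangle s) : Prop :=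
  ∀ C : T.Arc → Q, IsColoring tri dia T C →
    ∃! C' : T'.Arc → Q, IsColoring tri dia T' C' ∧ ∀ j, C' (T'.bdArc () j) = C (T.bdArc () j)

variable {ι : Type} {t : ι → Boundary} {O : DiagramData (addHole s.dual t)} {T : Tangle s}
  {D : DiagramData t}

theorem Gluing.arc_meet (g : Gluing O T D) (j : Fin s.n) :
    g.arc (.inl (O.bdArc none (Fin.rev j))) = g.arc (.inr (T.bdArc () j)) :=
  (g.arc_eq_iff _ _).2 (.rel _ _ ⟨j, rfl, rfl⟩)

/-- A coloring of a glued diagram is a coloring of both parts. -/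
theorem Gluing.isColoring_iff {tri dia : Q → Q → Q} (g : Gluing O T D) (C : D.Arc → Q) :
    IsColoring tri dia D C ↔ IsColoring tri dia O (fun a => C (g.arc (.inl a))) ∧
      IsColoring tri dia T (fun a => C (g.arc (.inr a))) := by
  constructor
  · intro h
    refine ⟨⟨fun c => ?_, fun v => ?_⟩, ⟨fun c => ?_, fun v => ?_⟩⟩
    · simpa only [g.overDir_crossing, g.crossArc_inl, Sum.elim_inl] using
        h.crossing (g.crossing (.inl c))
    · simpa only [g.isZip_vertex, g.tip_vertex, g.vertArc_inl, Sum.elim_inl] using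
        h.vertex (g.vertex (.inl v))
    · simpa only [g.overDir_crossing, g.crossArc_inr, Sum.elim_inr] using
        h.crossing (g.crossing (.inr c))
    · simpa only [g.isZip_vertex, g.tip_vertex, g.vertArc_inr, Sum.elim_inr] using
        h.vertex (g.vertex (.inr v))
  · rintro ⟨hO, hT⟩
    refine ⟨fun c => ?_, fun v => ?_⟩
    · obtain ⟨c | c, rfl⟩ := g.crossing.surjective c
      · simpa only [g.overDir_crossing, g.crossArc_inl, Sum.elim_inl] using hO.crossing c
      · simpa only [g.overDir_crossing, g.crossArc_inr, Sum.elim_inr] using hT.crossing c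
    · obtain ⟨v | v, rfl⟩ := g.vertex.surjective v
      · simpa only [g.isZip_vertex, g.tip_vertex, g.vertArc_inl, Sum.elim_inl] using hO.vertex v
      · simpa only [g.isZip_vertex, g.tip_vertex, g.vertArc_inr, Sum.elim_inr] using hT.vertex v

/-- Colors on both parts that agree on the circle define colors on the glued diagram. -/
theorem Gluing.exists_colors (g : Gluing O T D) (CO : O.Arc → Q) (CT : T.Arc → Q)
    (h : ∀ j, CO (O.bdArc none (Fin.rev j)) = CT (T.bdArc () j)) :
    ∃ C : D.Arc → Q, (∀ a, C (g.arc (.inl a)) = CO a) ∧ ∀ a, C (g.arc (.inr a)) = CT a := by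
  have key : ∀ x y, Relation.EqvGen (Meets O T) x y →
      Sum.elim CO CT x = Sum.elim CO CT y := by
    intro x y hxy
    induction hxy with
    | rel x y hxy =>
      obtain ⟨j, rfl, rfl⟩ := hxy
      exact h j
    | refl x => rfl
    | symm x y _ ih => exact ih.symm
    | trans x y z _ _ ih ih' => exact ih.trans ih'
  have hs := Function.surjInv_eq g.arc_surjective
  refine ⟨fun a => Sum.elim CO CT (Function.surjInv g.arc_surjective a), fun a => ?_,
    fun a => ?_⟩
  · exact key _ (.inl a) ((g.arc_eq_iff _ _).1 (hs _))
  · exact key _ (.inr a) ((g.arc_eq_iff _ _).1 (hs _))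

/-- The exterior keeps its colors and thereby prescribes the boundary colors of `T'`; the unique
coloring inside is glued to it, and any competitor restricts to a coloring of `T'` with the same
boundary colors. -/
theorem TangleColoringsExtend.coloringsExtend {tri dia : Q → Q → Q} {T T' : Tangle s}
    (h : TangleColoringsExtend tri dia T T') : ColoringsExtend tri dia T T' := by
  intro ι _ t O D D' _ _ _ g g' C hC
  obtain ⟨hO, hT⟩ := (g.isColoring_iff C).1 hC
  obtain ⟨CT, ⟨hCT, hbd⟩, huniq⟩ := h _ hT
  obtain ⟨C', hl, hr⟩ := g'.exists_colors (fun a => C (g.arc (.inl a))) CT fun j =>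
      (congrArg C (g.arc_meet j)).trans (hbd j).symm
  refine ⟨C', ⟨(g'.isColoring_iff C').2 ⟨?_, ?_⟩, hl⟩, ?_⟩
  · simpa only [hl] using hO
  · simpa only [hr] using hCT
  · rintro C'' ⟨hC'', hext⟩
    have hCT' := huniq (fun a => C'' (g'.arc (.inr a))) ⟨((g'.isColoring_iff C'').1 hC'').2,
      fun j => (congrArg C'' (g'.arc_meet j)).symm.trans
        ((hext _).trans (congrArg C (g.arc_meet j)))⟩
    funext a
    obtain ⟨a | a, rfl⟩ := g'.arc_surjective a
    · rw [hext, hl]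
    · rw [hr, ← hCT']

/-- The annulus in which the boundary points of a disc are joined to those of an outer circle. -/
def annulus (s : Boundary) : DiagramData (addHole s.dual fun _ : Unit => s) where
  Crossing := Empty
  Vertex := Empty
  Arc := Fin s.n
  overDir := Empty.elim
  underDir := Empty.elim
  isZip := Empty.elim
  tip := Empty.elim
  crossArc := Empty.elim
  vertArc := Empty.elim
  bdArc
    | none => fun j => j.rev
    | some _ => id

/-- Reversal conjugates the rotation to its inverse. This is what closes each face of the annulus
after two steps. -/
theorem finRotate_rev_finRotate_rev {n : ℕ} (j : Fin n) :
    finRotate n (finRotate n j.rev).rev = j := by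
  obtain _ | n := n
  · exact j.elim0
  · rw [finRotate_apply, finRotate_apply, Fin.rev_add, Fin.rev_rev, sub_add_cancel]

theorem isDiagram_annulus (hs : 0 < s.n) : (annulus s).IsDiagram := by
  have hwf : (annulus s).WellFormed := by
    constructor
    · rintro (⟨⟨⟩, _⟩ | ⟨⟨⟩, _⟩ | ⟨_ | i, j⟩) (⟨⟨⟩, _⟩ | ⟨⟨⟩, _⟩ | ⟨_ | i', j'⟩) h h'
      · obtain rfl : j = j' := Fin.rev_injective h'
        rfl
      · obtain rfl : j.rev = j' := h'
        exact absurd h (Bool.not_ne_self _)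
      · obtain rfl : j = Fin.rev j' := h'
        exact absurd h.symm (Bool.not_ne_self _)
      · obtain rfl : j = j' := h'
        rfl
    · rintro (⟨⟨⟩, _⟩ | ⟨⟨⟩, _⟩ | ⟨_ | i, j⟩)
      · exact ⟨.inr (.inr ⟨some (), Fin.rev j⟩), rfl, (Bool.not_ne_self _).symm⟩
      · refine ⟨.inr (.inr ⟨none, Fin.rev j⟩), Fin.rev_rev j, ?_⟩
        exact (congrArg (fun i => !s.starts i) (Fin.rev_rev (n := s.n) j)).trans_ne
          (Bool.not_ne_self _)
  refine ⟨inferInstanceAs (Finite Empty), inferInstanceAs (Finite Empty),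
    inferInstanceAs (Finite (Fin s.n)), hwf, ?_⟩
  have hnode : Nat.card (annulus s).NodeOrbit = 2 := by
    rw [DiagramData.card_nodeOrbit _ (by rintro (_ | _) <;> exact hs)]
    change Nat.card (Empty ⊕ Empty ⊕ Option Unit) = _
    simp
  have hrange : Nat.card (Set.range (annulus s).arcAt) = s.n := by
    have : Function.Surjective (annulus s).arcAt := fun a => ⟨.inr (.inr ⟨some (), a⟩), rfl⟩
    rw [Set.range_eq_univ.2 this, Nat.card_univ]
    exact Nat.card_fin _
  have hface : Nat.card (annulus s).Face = s.n := by
    -- The faces are the strips between neighbouring arcs, each with one port on either circle; a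
    -- face is named after its port on the outer one, which gets rank `0`.
    let f : (annulus s).Port → Fin s.n
      | .inl x => x.1.elim
      | .inr (.inl x) => x.1.elim
      | .inr (.inr ⟨none, j⟩) => finRotate s.n (Fin.rev j)
      | .inr (.inr ⟨some _, j⟩) => j
    let r : (annulus s).Port → ℕ
      | .inl x => x.1.elim
      | .inr (.inl x) => x.1.elim
      | .inr (.inr ⟨none, _⟩) => 1
      | .inr (.inr ⟨some _, _⟩) => 0
    refine (card_quot_eq_of_rank f r ?_ ?_ ?_ ?_).trans (Nat.card_fin _)
    · rintro (⟨⟨⟩, _⟩ | ⟨⟨⟩, _⟩ | ⟨_ | i, j⟩) _ ⟨⟨⟨⟩, _⟩ | ⟨⟨⟩, _⟩ | ⟨_ | i', j'⟩, hne, h, rfl⟩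
      · obtain rfl : j' = j := Fin.rev_injective h
        exact absurd rfl hne
      · obtain rfl : j' = Fin.rev j := h
        rfl
      · obtain rfl : Fin.rev j' = j := h
        have := finRotate_rev_finRotate_rev (Fin.rev j')
        rw [Fin.rev_rev] at this
        exact this.symm
      · obtain rfl : j' = j := h
        exact absurd rfl hne
    · exact fun a => ⟨.inr (.inr ⟨some (), a⟩), rfl⟩
    · rintro (⟨⟨⟩, _⟩ | ⟨⟨⟩, _⟩ | ⟨_ | i, j⟩) (⟨⟨⟩, _⟩ | ⟨⟨⟩, _⟩ | ⟨_ | i', j'⟩) h h' hf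
      · exact absurd h one_ne_zero
      · exact absurd h one_ne_zero
      · exact absurd h' one_ne_zero
      · obtain rfl : j = j' := hf
        rfl
    · rintro (⟨⟨⟩, _⟩ | ⟨⟨⟩, _⟩ | ⟨_ | i, j⟩) h
      · refine ⟨.inr (.inr ⟨some (), finRotate s.n (Fin.rev j)⟩),
          ⟨.inr (.inr ⟨none, Fin.rev (finRotate s.n (Fin.rev j))⟩), ?_, Fin.rev_rev _, ?_⟩,
          Nat.one_pos⟩
        · exact fun h => by cases h
        · exact congrArg (fun i : Fin s.n => (Sum.inr (Sum.inr ⟨none, i⟩) : (annulus s).Port))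
            (finRotate_rev_finRotate_rev (n := s.n) j).symm
      · exact absurd rfl h
  have hcomp : Nat.card (annulus s).Component = 1 := by
    let root : (annulus s).Port := .inr (.inr ⟨some (), ⟨0, hs⟩⟩)
    rw [Nat.card_eq_one_iff_unique]
    have hbd : ∀ j : Fin s.n, (Quot.mk _ (.inr (.inr ⟨some (), j⟩)) : (annulus s).Component) =
        Quot.mk _ root := fun j => (annulus s).component_eq_of_node_eq rfl
    have : ∀ x, (Quot.mk _ x : (annulus s).Component) = Quot.mk _ root := by
      rintro (⟨⟨⟩, _⟩ | ⟨⟨⟩, _⟩ | ⟨_ | i, j⟩)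
      · refine Eq.trans ?_ (hbd (Fin.rev (n := s.n) j))
        exact (annulus s).component_eq_of_arcAt_eq rfl
      · exact hbd j
    refine ⟨⟨?_⟩, ⟨Quot.mk _ root⟩⟩
    rintro ⟨x⟩ ⟨y⟩
    exact (this x).trans (this y).symm
  rw [DiagramData.Planar, hnode, hface, hrange, hcomp, add_comm]

/-- Gluing the annulus to a tangle gives the tangle back. -/
def annulusGluing (T : Tangle s) : Gluing (annulus s) T T where
  crossing := Equiv.emptySum Empty T.Crossing
  vertex := Equiv.emptySum Empty T.Vertex
  arc := Sum.elim (T.bdArc ()) id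
  arc_surjective := fun a => ⟨.inr a, rfl⟩
  arc_eq_iff := by
    have key : ∀ x : (annulus s).Arc ⊕ T.Arc,
        Relation.EqvGen (Meets (annulus s) T) x (.inr (Sum.elim (T.bdArc ()) id x)) := by
      rintro (j | a)
      · refine .rel _ _ ⟨j, ?_, rfl⟩
        exact congrArg Sum.inl (Fin.rev_rev j).symm
      · exact .refl _
    refine fun x y => ⟨fun h => ?_, fun h => ?_⟩
    · exact (key x).trans _ _ _ (h ▸ (key y).symm)
    · induction h with
      | rel x y hxy =>
        obtain ⟨j, rfl, rfl⟩ := hxy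
        exact congrArg (T.bdArc ()) (Fin.rev_rev j)
      | refl x => rfl
      | symm x y _ ih => exact ih.symm
      | trans x y z _ _ ih ih' => exact ih.trans ih'
  overDir_crossing := by rintro (⟨⟨⟩⟩ | c); rfl
  underDir_crossing := by rintro (⟨⟨⟩⟩ | c); rfl
  isZip_vertex := by rintro (⟨⟨⟩⟩ | c); rfl
  tip_vertex := by rintro (⟨⟨⟩⟩ | c); rfl
  crossArc_inl := by rintro ⟨⟩
  crossArc_inr := fun _ _ => rfl
  vertArc_inl := by rintro ⟨⟩
  vertArc_inr := fun _ _ => rfl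
  bdArc_eq := fun _ _ => rfl

/-- Whether colorings extend over the replacement of a tangle is decided inside the ball. -/
theorem coloringsExtend_iff {tri dia : Q → Q → Q} {T T' : Tangle s} (hs : 0 < s.n)
    (hT : T.IsDiagram) (hT' : T'.IsDiagram) :
    ColoringsExtend tri dia T T' ↔ TangleColoringsExtend tri dia T T' :=
  -- With the annulus as exterior, agreement outside the ball is agreement of boundary colors.
  ⟨fun h => h Unit _ (annulus s) T T' (isDiagram_annulus hs) hT hT' (annulusGluing T)
    (annulusGluing T'), fun h => h.coloringsExtend⟩

end Local

/-! ## Colorings of tangles in terms of the colors on the boundary -/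

section Description

variable {Q : Type*} {s : Boundary}

/-- The colorings of `T` are determined by their boundary colors `x` as `E x`, and the boundary
colors that occur are those satisfying `B`. -/
def Describes (tri dia : Q → Q → Q) (T : Tangle s) (B : (Fin s.n → Q) → Prop)
    (E : (Fin s.n → Q) → T.Arc → Q) : Prop :=
  (∀ C, IsColoring tri dia T C ↔
    B (fun j => C (T.bdArc () j)) ∧ E (fun j => C (T.bdArc () j)) = C) ∧
  ∀ x j, B x → E x (T.bdArc () j) = x j

variable {tri dia : Q → Q → Q} {T T' : Tangle s} {B B' : (Fin s.n → Q) → Prop}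
  {E : (Fin s.n → Q) → T.Arc → Q} {E' : (Fin s.n → Q) → T'.Arc → Q}

/-- Boundary colors determine the coloring of `T'`, so uniqueness is automatic and only the
existence of a coloring with given boundary colors is at stake. -/
theorem Describes.tangleColoringsExtend_iff (h : Describes tri dia T B E)
    (h' : Describes tri dia T' B' E') :
    TangleColoringsExtend tri dia T T' ↔ ∀ x, B x → B' x := by
  constructor
  · intro hTT' x hx
    have hbd : (fun j => E x (T.bdArc () j)) = x := funext fun j => h.2 x j hx
    obtain ⟨C', ⟨hC', hext⟩, -⟩ := hTT' (E x) ((h.1 _).2 (by rw [hbd]; exact ⟨hx, rfl⟩))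
    have := ((h'.1 C').1 hC').1
    rwa [funext hext, hbd] at this
  · intro hB C hC
    have hx := ((h.1 C).1 hC).1
    have hbd := funext fun j => h'.2 _ j (hB _ hx)
    refine ⟨E' fun j => C (T.bdArc () j), ⟨(h'.1 _).2 ?_, fun j => h'.2 _ j (hB _ hx)⟩, ?_⟩
    · rw [hbd]
      exact ⟨hB _ hx, rfl⟩
    · rintro C' ⟨hC', hext⟩
      rw [← ((h'.1 C').1 hC').2, funext hext]

theorem isTopological_singleton_iff {m : Move} (hm : 0 < m.boundary.n)
    (hl : m.lhs.IsDiagram) (hr : m.rhs.IsDiagram) {B B' : (Fin m.boundary.n → Q) → Prop}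
    {E : (Fin m.boundary.n → Q) → m.lhs.Arc → Q} {E' : (Fin m.boundary.n → Q) → m.rhs.Arc → Q}
    (h : Describes tri dia m.lhs B E) (h' : Describes tri dia m.rhs B' E') :
    IsTopological tri dia {m} ↔ ∀ x, B x ↔ B' x := by
  simp only [IsTopological, Set.mem_singleton_iff, forall_eq, coloringsExtend_iff hm hl hr,
    coloringsExtend_iff hm hr hl, h.tangleColoringsExtend_iff h', h'.tangleColoringsExtend_iff h,
    iff_def, forall_and]

end Description

/-! ## The operation of a crossing -/

section Act

variable {Q : Type*} {tri inv : Q → Q → Q}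

/-- The action of an over-strand, or its inverse. -/
def act (tri inv : Q → Q → Q) (e : Bool) (a b : Q) : Q :=
  if e then tri a b else inv a b

/-- `inv` is the inverse operation of `tri`. -/
def IsInverse (tri inv : Q → Q → Q) : Prop :=
  ∀ a b, inv (tri a b) b = a ∧ tri (inv a b) b = a

theorem act_eq_iff (h : IsInverse tri inv) (e : Bool) {a b c : Q} :
    act tri inv e a b = c ↔ a = act tri inv (!e) c b := by
  cases e
  · exact ⟨fun hc => hc ▸ (h a b).2.symm, fun ha => ha ▸ (h c b).1⟩
  · exact ⟨fun hc => hc ▸ (h a b).1.symm, fun ha => ha ▸ (h c b).2⟩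

theorem act_act_not (h : IsInverse tri inv) (e : Bool) (a b : Q) :
    act tri inv e (act tri inv (!e) a b) b = a :=
  (act_eq_iff h e).2 rfl

theorem act_not_act (h : IsInverse tri inv) (e : Bool) (a b : Q) :
    act tri inv (!e) (act tri inv e a b) b = a :=
  ((act_eq_iff h e).1 rfl).symm

theorem act_right_cancel (h : IsInverse tri inv) (e : Bool) {a a' b : Q}
    (hab : act tri inv e a b = act tri inv e a' b) : a = a' := by
  rw [(act_eq_iff h e).1 hab, act_not_act h]

theorem act_self (h : IsInverse tri inv) (hi : Idempotent tri) (e : Bool) (a : Q) :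
    act tri inv e a a = a := by
  cases e
  · have := (h a a).1
    rwa [hi] at this
  · exact hi a

/-- Solving for port `3` treats both directions of the over-strand alike, so each crossing becomes
an assignment. -/
theorem crossingRule_iff (h : IsInverse tri inv) (e : Bool) (x : Fin 4 → Q) :
    CrossingRule tri e x ↔ x 2 = x 0 ∧ x 3 = act tri inv e (x 1) (x 0) := by
  refine and_congr_right fun _ => ?_
  cases e
  · exact eq_comm.trans (act_eq_iff h true)
  · exact Iff.rfl

/-- An endomorphism of `tri` commutes with `act`. -/
theorem map_act (h : IsInverse tri inv) (e : Bool) (f : Q → Q)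
    (hf : ∀ a b, f (tri a b) = tri (f a) (f b)) (a b : Q) :
    f (act tri inv e a b) = act tri inv e (f a) (f b) := by
  cases e
  · have : act tri inv true (f (inv a b)) (f b) = f a := by
      change tri _ _ = _
      rw [← hf, (h a b).2]
    exact (act_eq_iff h true).1 this
  · exact hf a b

/-- By self-distributivity translation by `c` is an endomorphism of `tri`, hence so is its inverse,
and `map_act` applies. This covers every orientation of RIII, the direction of the lowest strand
playing no role. -/
theorem act_act (h : IsInverse tri inv) (hd : SelfDistrib tri) (e e' : Bool) (a b c : Q) :
    act tri inv e (act tri inv e' a b) c =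
      act tri inv e' (act tri inv e a c) (act tri inv e b c) := by
  refine map_act h e' (fun a => act tri inv e a c) (fun a b => ?_) a b
  cases e
  · have := hd (inv a c) (inv b c) c
    rw [(h a c).2, (h b c).2] at this
    exact ((act_eq_iff h true).1 this).symm
  · exact hd a b c

end Act

/-! ## Colorings of the moves -/

section Moves

variable {Q : Type*} {tri inv dia : Q → Q → Q}

local notation "⟪" e "⟫" => act tri inv e

theorem vec3_eta (x : Fin 3 → Q) : ![x 0, x 1, x 2] = x := by
  funext i
  fin_cases i <;> rfl

/-- Puts crossings in solved form and vertex colors in explicit vectors, so that each move becomes a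
finite system of equations for `simp` and `grind`. -/
theorem describes_finTangle (h : IsInverse tri inv) {n c v a : ℕ} {st : Fin n → Bool}
    {overDir underDir : Fin c → Bool} {isZip : Fin v → Bool} {tip : Fin v → Fin 3}
    {crossArc : Fin c → Fin 4 → Fin a} {vertArc : Fin v → Fin 3 → Fin a} {bdArc : Fin n → Fin a}
    {B : (Fin n → Q) → Prop} {E : (Fin n → Q) → Fin a → Q}
    (hiff : ∀ C : Fin a → Q,
      ((∀ i, C (crossArc i 2) = C (crossArc i 0) ∧
          C (crossArc i 3) = ⟪overDir i⟫ (C (crossArc i 1)) (C (crossArc i 0))) ∧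
        ∀ i, VertexRule dia (isZip i) (tip i)
          ![C (vertArc i 0), C (vertArc i 1), C (vertArc i 2)]) ↔
      B (fun j => C (bdArc j)) ∧ ∀ i, E (fun j => C (bdArc j)) i = C i)
    (hbd : ∀ x, B x → ∀ j, E x (bdArc j) = x j) :
    Describes tri dia (finTangle ⟨n, st⟩ overDir underDir isZip tip crossArc vertArc bdArc)
      B E := by
  refine ⟨fun C => ?_, fun x j hx => hbd x hx j⟩
  rw [funext_iff]
  rw [← hiff C]
  have hvec : ∀ i : Fin v, ![C (vertArc i 0), C (vertArc i 1), C (vertArc i 2)] =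
      fun p => C (vertArc i p) := fun i => vec3_eta fun p => C (vertArc i p)
  simp only [hvec]
  exact ⟨fun hC => ⟨fun i => (crossingRule_iff h _ _).1 (hC.crossing i), fun i => hC.vertex i⟩,
    fun hC => ⟨fun i => (crossingRule_iff h _ _).2 (hC.1 i), fun i => hC.2 i⟩⟩

theorem describes_moveI_lhs (h : IsInverse tri inv) (d : Bool) :
    Describes tri dia (moveI d).lhs
      (fun x : Fin 2 → Q => x 0 = ⟪!d⟫ (x 1) (x 1))
      fun x : Fin 2 → Q => ![x 0, x 1, x 1] := by
  refine describes_finTangle h (fun C => ?_) fun x hx => ?_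
  · simp [Fin.forall_fin_succ]
    grind
  · simp [Fin.forall_fin_succ]

theorem describes_moveI_rhs (h : IsInverse tri inv) (d : Bool) :
    Describes tri dia (moveI d).rhs
      (fun x : Fin 2 → Q => x 0 = x 1)
      fun x : Fin 2 → Q => ![x 0] := by
  refine describes_finTangle h (fun C => ?_) fun x hx => ?_
  · simp [Fin.forall_fin_succ]
  · simp [Fin.forall_fin_succ]
    grind

/-- Both crossings present the middle arc of `A` as the image of an end of `A` under the same
injective translation, so the two ends agree. -/
theorem describes_moveII_lhs (h : IsInverse tri inv) (a b : Bool) :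
    Describes tri dia (moveII a b).lhs
      (fun x : Fin 4 → Q => x 0 = x 3 ∧ x 1 = x 2)
      fun x : Fin 4 → Q => ![x 3, x 3, x 3, x 2, ⟪b⟫ (x 2) (x 3), x 1] := by
  refine describes_finTangle h (fun C => ?_) fun x hx => ?_
  · simp [Fin.forall_fin_succ]
    grind [act_right_cancel h]
  · simp [Fin.forall_fin_succ]
    grind

theorem describes_moveII_rhs (h : IsInverse tri inv) (a b : Bool) :
    Describes tri dia (moveII a b).rhs
      (fun x : Fin 4 → Q => x 0 = x 3 ∧ x 1 = x 2)
      fun x : Fin 4 → Q => ![x 0, x 1] := by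
  refine describes_finTangle h (fun C => ?_) fun x hx => ?_
  · simp [Fin.forall_fin_succ]
  · simp [Fin.forall_fin_succ]
    grind

/-- Colors are propagated upwards from the free bottom ends; the two sides of the move differ only
in the resulting top color of `U`. -/
theorem describes_moveIII_lhs (h : IsInverse tri inv) (u m v : Bool) :
    Describes tri dia (moveIII u m v).lhs
      (fun x : Fin 6 → Q => x 2 = x 5 ∧ x 1 = ⟪!v⟫ (x 4) (x 5) ∧ x 0 = ⟪!m⟫ (⟪!v⟫ (x 3) (x 5)) (x 1))
      fun x : Fin 6 → Q => ![x 0, ⟪!v⟫ (x 3) (x 5), x 3, x 1, x 1, x 4, x 5, x 5, x 5] := by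
  refine describes_finTangle h (fun C => ?_) fun x hx => ?_
  · simp [Fin.forall_fin_succ]
    grind
  · simp [Fin.forall_fin_succ]
    grind

theorem describes_moveIII_rhs (h : IsInverse tri inv) (u m v : Bool) :
    Describes tri dia (moveIII u m v).rhs
      (fun x : Fin 6 → Q => x 2 = x 5 ∧ x 1 = ⟪!v⟫ (x 4) (x 5) ∧ x 0 = ⟪!v⟫ (⟪!m⟫ (x 3) (x 4)) (x 5))
      fun x : Fin 6 → Q => ![x 0, ⟪!m⟫ (x 3) (x 4), x 3, x 1, x 4, x 4, x 5, x 5, x 5] := by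
  refine describes_finTangle h (fun C => ?_) fun x hx => ?_
  · simp [Fin.forall_fin_succ]
    grind
  · simp [Fin.forall_fin_succ]
    grind

theorem describes_moveIV_lhs (h : IsInverse tri inv) (d z : Bool) (j : Fin 3) :
    Describes tri dia (moveIV d z j).lhs
      (fun x : Fin 5 → Q => VertexRule dia z j ![x 4, x 2, x 1] ∧ x 0 = ⟪!vertexOut z j 0⟫ (x 3) (x 4))
      fun x : Fin 5 → Q => ![x 0, x 3, x 4, x 4, x 2, x 1] := by
  refine describes_finTangle h (fun C => ?_) fun x hx => ?_
  · simp [Fin.forall_fin_succ]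
    grind
  · simp [Fin.forall_fin_succ]

theorem describes_moveIV_rhs (h : IsInverse tri inv) (d z : Bool) (j : Fin 3) :
    Describes tri dia (moveIV d z j).rhs
      (fun x : Fin 5 → Q => VertexRule dia z j ![x 4, x 2, x 1] ∧
        x 0 = ⟪vertexOut z j 2⟫ (⟪vertexOut z j 1⟫ (x 3) (x 2)) (x 1))
      fun x : Fin 5 → Q => ![x 0, ⟪vertexOut z j 1⟫ (x 3) (x 2), x 3, x 4, x 1, x 1, x 2, x 2] := by
  refine describes_finTangle h (fun C => ?_) fun x hx => ?_
  · simp [Fin.forall_fin_succ]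
    grind
  · simp [Fin.forall_fin_succ]

theorem describes_moveV_lhs (h : IsInverse tri inv) (z : Bool) (j : Fin 3) :
    Describes tri dia (moveV z j).lhs
      (fun x : Fin 3 → Q => VertexRule dia z (-j) ![x 2, ⟪!vertexOut z j 1⟫ (x 0) (x 1), x 1])
      fun x : Fin 3 → Q => ![x 2, ⟪!vertexOut z j 1⟫ (x 0) (x 1), x 0, x 1, x 1] := by
  refine describes_finTangle h (fun C => ?_) fun x hx => ?_
  · simp [Fin.forall_fin_succ]
    grind [act_act_not h, act_not_act h]
  · simp [Fin.forall_fin_succ]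

theorem describes_moveV_rhs (h : IsInverse tri inv) (z : Bool) (j : Fin 3) :
    Describes tri dia (moveV z j).rhs
      (fun x : Fin 3 → Q => VertexRule dia z j ![x 2, x 1, x 0])
      fun x : Fin 3 → Q => ![x 2, x 1, x 0] := by
  refine describes_finTangle h (fun C => ?_) fun x hx => ?_
  · simp [Fin.forall_fin_succ]
  · simp [Fin.forall_fin_succ]

theorem describes_moveVI_lhs (h : IsInverse tri inv) (d z : Bool) (j : Fin 3) :
    Describes tri dia (moveVI d z j).lhs
      (fun x : Fin 5 → Q => x 2 = x 4 ∧ VertexRule dia z j ![⟪!d⟫ (x 3) (x 4), x 1, x 0])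
      fun x : Fin 5 → Q => ![x 4, x 4, ⟪!d⟫ (x 3) (x 4), x 3, x 1, x 0] := by
  refine describes_finTangle h (fun C => ?_) fun x hx => ?_
  · simp [Fin.forall_fin_succ]
    grind
  · simp [Fin.forall_fin_succ]
    grind

theorem describes_moveVI_rhs (h : IsInverse tri inv) (d z : Bool) (j : Fin 3) :
    Describes tri dia (moveVI d z j).rhs
      (fun x : Fin 5 → Q => x 2 = x 4 ∧ VertexRule dia z j ![x 3, ⟪d⟫ (x 1) (x 4), ⟪d⟫ (x 0) (x 4)])
      fun x : Fin 5 → Q => ![x 4, x 4, x 4, x 3, ⟪d⟫ (x 1) (x 4), x 1, ⟪d⟫ (x 0) (x 4), x 0] := by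
  refine describes_finTangle h (fun C => ?_) fun x hx => ?_
  · simp [Fin.forall_fin_succ]
    grind [act_act_not h, act_not_act h]
  · simp [Fin.forall_fin_succ]
    grind

end Moves
-- Algebraic laws equivalent to the moves
section Laws

variable {Q : Type*} {tri inv dia : Q → Q → Q}

local notation "⟪" e "⟫" => act tri inv e

/-- Composability at all vertices: passing under a leg amounts to passing under the others. -/
theorem act_eq_act_act_of_vertexRule (h : IsInverse tri inv)
    (hc : TranslationComposable tri dia) (z : Bool) (j : Fin 3) {x : Fin 3 → Q}
    (hx : VertexRule dia z j x) (a : Q) :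
    ⟪!vertexOut z j 0⟫ a (x 0) = ⟪vertexOut z j 2⟫ (⟪vertexOut z j 1⟫ a (x 1)) (x 2) := by
  -- Undoing a composite translation undoes its factors in the opposite order.
  have hi : ∀ a b c, inv a (dia b c) = inv (inv a c) b := fun a b c => by
    refine ((act_eq_iff h true).1 ?_).symm
    change tri _ _ = _
    rw [hc, (h _ _).2, (h _ _).2]
  unfold IsInverse at h
  unfold TranslationComposable at hc
  fin_cases j <;> cases z <;> simp [VertexRule] at hx <;> simp [vertexOut, act] <;> grind

/-- With tip `0` the crossing legs are co-oriented and semi-commutativity suffices. With tip `1` the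
over-color `b` is itself a product, and composability with idempotence identifies its action with
that of the factor `c`. With tip `2` the under-color is a product, and `hswap` moves it across. -/
theorem vertexRule_neg (h : IsInverse tri inv) (hi : Idempotent tri)
    (hc : TranslationComposable tri dia) (hD : DiaDistrib tri dia) (hs : SemiCommutative tri dia)
    (z : Bool) (j : Fin 3) (a b c : Q) :
    VertexRule dia z (-j) ![c, ⟪!vertexOut z j 1⟫ a b, b] ↔ VertexRule dia z j ![c, b, a] := by
  have hcancel : ∀ {a a' b}, tri a b = tri a' b → a = a' := act_right_cancel h true
  -- `(b ⋄ c) ◁ b = b ⋄ (c ◁ b) = c ⋄ b`.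
  have hswap : ∀ b c, tri (dia b c) b = dia c b := fun b c => by rw [hD, hi, ← hs]
  have hinv : ∀ a b c, inv a b = c ↔ a = tri c b := fun a b c => act_eq_iff h false
  fin_cases j <;> cases z
  · change c = dia (inv a b) b ↔ c = dia b a
    rw [hs (inv a b), (h a b).2]
  · change c = dia b (tri a b) ↔ c = dia a b
    rw [← hs]
  · change b = dia c (tri a b) ↔ b = dia a c
    constructor <;> intro hb
    · have : tri a b = tri a c := by
        -- Both elements have image `a ◁ b` under translation by `a ◁ b`: one by (Comp) and the
        -- formula for `b`, the other by idempotence.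
        refine (hcancel (b := tri a b) ?_).symm
        rw [← hc, ← hb, hi]
      rw [hs, ← this, ← hb]
    · have : tri a b = tri a c := by
        rw [hb, hc, hi]
      rw [this, ← hs, ← hb]
  · change b = dia (inv a b) c ↔ b = dia c a
    constructor <;> intro hb
    · have : tri (inv a b) c = a := by
        refine Eq.trans ?_ (h a b).2
        nth_rw 3 [hb]
        rw [hc, hi]
      rw [← this, ← hs, ← hb]
    · have : inv a b = inv a c := by
        rw [hinv]
        rw [hb, hc, (h a c).2, hi]
      rw [hs, this, (h a c).2, ← hb]
  · change inv a b = dia b c ↔ a = dia c b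
    rw [hinv, hswap]
  · change tri a b = dia c b ↔ a = dia b c
    rw [← hswap]
    exact ⟨hcancel, fun ha => ha ▸ rfl⟩

/-- By (D) and invertibility translation by `s` is an automorphism of `dia`, and applying it to all
three colors preserves the vertex rule wherever the tip is. -/
theorem vertexRule_act (h : IsInverse tri inv) (hD : DiaDistrib tri dia) (e z : Bool) (j : Fin 3)
    (x y w s : Q) : VertexRule dia z j ![⟪!e⟫ x s, y, w] ↔
      VertexRule dia z j ![x, ⟪e⟫ y s, ⟪e⟫ w s] := by
  have hdia : ∀ a b, ⟪e⟫ (dia a b) s = dia (⟪e⟫ a s) (⟪e⟫ b s) := by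
    intro a b
    cases e
    · refine ((act_eq_iff h true).1 ?_).symm
      refine (hD _ _ _).trans ?_
      exact congrArg₂ dia (h a s).2 (h b s).2
    · exact hD a b s
  obtain ⟨x, rfl⟩ : ∃ y, x = ⟪e⟫ y s := ⟨_, (act_act_not h e x s).symm⟩
  rw [act_not_act h]
  have hinj : ∀ a b, ⟪e⟫ a s = ⟪e⟫ b s ↔ a = b :=
    fun a b => ⟨act_right_cancel h e, fun hab => hab ▸ rfl⟩
  fin_cases j <;> cases z <;> simp [VertexRule, ← hdia, hinj]

/-- Sliding a strand of color `a` under one of color `b` creates a middle arc whose color `c` must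
satisfy `c ◁ b = a`; unique extension is bijectivity of translation by `b`. The argument uses raw
colorings, since the descriptions above already presuppose an inverse. -/
theorem invertible_of_coloringsExtend
    (hII : TangleColoringsExtend tri dia (moveII false false).rhs (moveII false false).lhs) :
    Invertible tri := by
  have key : ∀ a b, ∃! c, tri c b = a := by
    intro a b
    obtain ⟨C, ⟨hC, hbd⟩, huniq⟩ := hII ![b, a] ⟨nofun, nofun⟩
    have h0 : C (0 : Fin 6) = b := hbd (3 : Fin 4)
    have h3 : C (3 : Fin 6) = a := hbd (2 : Fin 4)
    have hc : C (3 : Fin 6) = tri (C (4 : Fin 6)) (C (0 : Fin 6)) := (hC.crossing (0 : Fin 2)).2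
    refine ⟨C (4 : Fin 6), ?_, fun c hca => ?_⟩
    · change tri (C (4 : Fin 6)) b = a
      rw [← h3, hc, h0]
    · have hca' : tri c b = a := hca
      -- Any solution `c` gives a competing coloring, with `c` on the middle arc of `A`.
      have := huniq ![b, b, b, a, c, a] ⟨⟨Fin.forall_fin_two.2 ⟨⟨rfl, hca'.symm⟩, rfl, hca'.symm⟩,
        nofun⟩, ?_⟩
      · exact congrFun this (4 : Fin 6)
      · intro j
        change Fin 4 at j
        fin_cases j <;> rfl
  choose inv hinv huniq using key
  exact ⟨inv, fun a b => ⟨(huniq _ b a rfl).symm, hinv a b⟩⟩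

section Iff

variable (h : IsInverse tri inv)
include h

theorem isTopological_moveI_iff (d : Bool) :
    IsTopological tri dia {moveI d} ↔ Idempotent tri := by
  rw [isTopological_singleton_iff (m := moveI d) (Nat.succ_pos 1) (isDiagram_moveI_lhs d)
    (isDiagram_moveI_rhs d) (describes_moveI_lhs h d) (describes_moveI_rhs h d)]
  constructor
  · intro hB a
    have := (hB (![a, a] : Fin 2 → Q)).2 rfl
    cases d
    · exact this.symm
    · exact ((act_eq_iff h true).2 this)
  · intro hi x
    rw [act_self h hi]

theorem isTopological_moveII (a b : Bool) : IsTopological tri dia {moveII a b} :=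
  (isTopological_singleton_iff (m := moveII a b) (Nat.succ_pos 3) (isDiagram_moveII_lhs a b)
    (isDiagram_moveII_rhs a b) (describes_moveII_lhs h a b) (describes_moveII_rhs h a b)).2
    fun _ => Iff.rfl

theorem isTopological_moveIII_iff (u m v : Bool) : IsTopological tri dia {moveIII u m v} ↔
    ∀ a b c, ⟪!m⟫ (⟪!v⟫ a c) (⟪!v⟫ b c) = ⟪!v⟫ (⟪!m⟫ a b) c := by
  rw [isTopological_singleton_iff (m := moveIII u m v) (Nat.succ_pos 5)
    (isDiagram_moveIII_lhs u m v) (isDiagram_moveIII_rhs u m v) (describes_moveIII_lhs h u m v)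
    (describes_moveIII_rhs h u m v)]
  constructor
  · intro hB a b c
    -- The boundary colors forced on the left-hand side by the bottom colors `a, b, c`.
    exact ((hB (![⟪!m⟫ (⟪!v⟫ a c) (⟪!v⟫ b c), ⟪!v⟫ b c, c, a, b, c] : Fin 6 → Q)).1
      ⟨rfl, rfl, rfl⟩).2.2
  · intro hd x
    refine and_congr_right fun _ => and_congr_right fun hx => ?_
    rw [hx, hd]

theorem isTopological_moveIV (hc : TranslationComposable tri dia) (d z : Bool) (j : Fin 3) :
    IsTopological tri dia {moveIV d z j} := by
  refine (isTopological_singleton_iff (m := moveIV d z j) (Nat.succ_pos 4)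
    (isDiagram_moveIV_lhs d z j) (isDiagram_moveIV_rhs d z j) (describes_moveIV_lhs h d z j)
    (describes_moveIV_rhs h d z j)).2 fun x => and_congr_right fun hx => ?_
  exact (act_eq_act_act_of_vertexRule h hc z j hx _).symm ▸ Iff.rfl

/-- The tip gets color `b ⋄ c` and the ends of the strand get `a` and `(a ◁ b) ◁ c`, which is
consistent with passing under the two other legs; passing under the tip then gives (Comp). -/
theorem translationComposable_of_moveIV (d z : Bool)
    (ht : IsTopological tri dia {moveIV d z 0}) : TranslationComposable tri dia := by
  have hB := (isTopological_singleton_iff (m := moveIV d z 0) (Nat.succ_pos 4)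
    (isDiagram_moveIV_lhs d z 0) (isDiagram_moveIV_rhs d z 0) (describes_moveIV_lhs h d z 0)
    (describes_moveIV_rhs h d z 0)).1 ht
  intro a b c
  cases z
  · exact ((hB (![tri (tri a b) c, c, b, a, dia b c] : Fin 5 → Q)).2 ⟨rfl, rfl⟩).2.symm
  · refine (act_eq_iff h true).2
      ((hB (![a, b, c, tri (tri a b) c, dia b c] : Fin 5 → Q)).2 ⟨rfl, ?_⟩).2
    exact ((congrArg (inv · b) (h (tri a b) c).1).trans (h a b).1).symm

theorem isTopological_moveV_iff (z : Bool) (j : Fin 3) : IsTopological tri dia {moveV z j} ↔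
    ∀ a b c, VertexRule dia z (-j) ![c, ⟪!vertexOut z j 1⟫ a b, b] ↔
      VertexRule dia z j ![c, b, a] := by
  rw [isTopological_singleton_iff (m := moveV z j) (Nat.succ_pos 2) (isDiagram_moveV_lhs z j)
    (isDiagram_moveV_rhs z j) (describes_moveV_lhs h z j) (describes_moveV_rhs h z j)]
  exact ⟨fun hB a b c => hB (![a, b, c] : Fin 3 → Q), fun hB x => hB _ _ _⟩

/-- Here the crossing legs are the two factors of the product, so the move compares `a ⋄ b` with `b
⋄ (a ◁ b)` directly; for an unzip vertex the inverse appears and `a ◁ b` is substituted. -/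
theorem isTopological_moveV_zero_iff (z : Bool) :
    IsTopological tri dia {moveV z 0} ↔ SemiCommutative tri dia := by
  rw [isTopological_moveV_iff h]
  cases z
  · constructor
    · intro hB a b
      refine ((hB (tri a b) b (dia a b)).1 ?_)
      exact congrArg (dia · b) (h a b).1.symm
    · intro hs a b c
      change c = dia (inv a b) b ↔ c = dia b a
      rw [hs (inv a b), (h a b).2]
  · constructor
    · exact fun hB a b => (hB a b (dia a b)).2 rfl
    · intro hs a b c
      change c = dia b (tri a b) ↔ c = dia a b
      rw [← hs]

theorem isTopological_moveVI_iff (d z : Bool) (j : Fin 3) : IsTopological tri dia {moveVI d z j} ↔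
    ∀ x y w s, VertexRule dia z j ![⟪!d⟫ x s, y, w] ↔
      VertexRule dia z j ![x, ⟪d⟫ y s, ⟪d⟫ w s] := by
  rw [isTopological_singleton_iff (m := moveVI d z j) (Nat.succ_pos 4)
    (isDiagram_moveVI_lhs d z j) (isDiagram_moveVI_rhs d z j) (describes_moveVI_lhs h d z j)
    (describes_moveVI_rhs h d z j)]
  constructor
  · intro hB x y w s
    have := hB (![w, y, s, x, s] : Fin 5 → Q)
    exact (and_congr_right_iff.1 this) rfl
  · exact fun hB x => and_congr_right fun _ => hB _ _ _ _

theorem diaDistrib_of_moveVI (d z : Bool) (ht : IsTopological tri dia {moveVI d z 0}) :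
    DiaDistrib tri dia := by
  rw [isTopological_moveVI_iff h] at ht
  intro a b c
  -- The colors make one side of the move hold by cancelling a translation with its inverse; the
  -- other side is (D). The factors trade places between zip and unzip, as the ports do.
  cases d <;> cases z
  · exact ((ht (dia a b) (tri a c) (tri b c) c).2
      (congrArg₂ dia (h a c).1.symm (h b c).1.symm))
  · exact ((ht (dia a b) (tri b c) (tri a c) c).2
      (congrArg₂ dia (h a c).1.symm (h b c).1.symm))
  · exact (ht (tri (dia a b) c) a b c).1 (h _ _).1
  · exact (ht (tri (dia a b) c) b a c).1 (h _ _).1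

end Iff

end Laws

/-! ### Assembling the equivalences -/

theorem IsTopological.singleton {Q : Type*} {tri dia : Q → Q → Q} {M : Set Move}
    (hM : IsTopological tri dia M) {m : Move} (hm : m ∈ M) : IsTopological tri dia {m} := by
  rintro _ rfl
  exact hM _ hm

theorem isTopological_rMove_iff {Q : Type*} (tri dia : Q → Q → Q) :
    IsTopological tri dia RMove ↔ IsQualgebra tri dia := by
  constructor
  · intro hM
    -- The inverse must come first, because the criteria for the other moves are stated in terms of
    -- it.
    obtain ⟨inv, h⟩ : Invertible tri := invertible_of_coloringsExtend (dia := dia)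
      ((coloringsExtend_iff (Nat.succ_pos 3) (isDiagram_moveII_rhs _ _)
        (isDiagram_moveII_lhs _ _)).1 (hM _ (.II false false)).2)
    refine ⟨⟨?_, ⟨inv, h⟩, ?_⟩, ?_, ?_, ?_⟩
    · intro a b c
      -- With all parameters false every action in the criterion is `tri` itself.
      exact ((isTopological_moveIII_iff h _ _ _).1
        (hM.singleton (.III false false false)) a b c).symm
    · exact (isTopological_moveI_iff h _).1 (hM.singleton (.I true))
    · exact translationComposable_of_moveIV h _ _ (hM.singleton (.IV true true 0))
    · exact diaDistrib_of_moveVI h _ _ (hM.singleton (.VI true true 0))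
    · exact (isTopological_moveV_zero_iff h _).1 (hM.singleton (.V true 0))
  · rintro ⟨⟨hd, ⟨inv, h⟩, hi⟩, hc, hD, hs⟩ m hm
    suffices IsTopological tri dia {m} from this m rfl
    cases hm with
    | I d => exact (isTopological_moveI_iff h d).2 hi
    | II a b => exact isTopological_moveII h a b
    | III u m v =>
      exact (isTopological_moveIII_iff h u m v).2 fun a b c => (act_act h hd _ _ a b c).symm
    | IV d z j => exact isTopological_moveIV h hc d z j
    | V z j => exact (isTopological_moveV_iff h z j).2 (vertexRule_neg h hi hc hD hs z j)
    | VI d z j => exact (isTopological_moveVI_iff h d z j).2 (vertexRule_act h hD d z j)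

end GraphColoring

open GraphColoring in
theorem propositionP {Q : Type*} (tri dia : Q → Q → Q) :
    (IsTopological tri dia RMove ↔ IsQualgebra tri dia) ∧
    (IsQuandle tri →
      ((IsTopological tri dia {moveIVz} ↔ TranslationComposable tri dia) ∧
       (IsTopological tri dia {moveIVu} ↔ TranslationComposable tri dia) ∧
       (IsTopological tri dia {moveVz} ↔ SemiCommutative tri dia) ∧
       (IsTopological tri dia {moveVu} ↔ SemiCommutative tri dia) ∧
       (IsTopological tri dia {moveVIz} ↔ DiaDistrib tri dia) ∧
       (IsTopological tri dia {moveVIu} ↔ DiaDistrib tri dia))) := by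
  refine ⟨isTopological_rMove_iff tri dia, ?_⟩
  rintro ⟨-, ⟨inv, h⟩, -⟩
  exact ⟨⟨translationComposable_of_moveIV h _ _, fun hc => isTopological_moveIV h hc _ _ _⟩,
    ⟨translationComposable_of_moveIV h _ _, fun hc => isTopological_moveIV h hc _ _ _⟩,
    isTopological_moveV_zero_iff h _, isTopological_moveV_zero_iff h _,
    ⟨diaDistrib_of_moveVI h _ _,
      fun hD => (isTopological_moveVI_iff h _ _ _).2 (vertexRule_act h hD _ _ _)⟩,
    ⟨diaDistrib_of_moveVI h _ _,
      fun hD => (isTopological_moveVI_iff h _ _ _).2 (vertexRule_act h hD _ _ _)⟩⟩
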